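/- Let $K/k$ be a finite Galois extension of fields. A two-sided vector space is a $k$-central $K$-$K$-bimodule (equivalently, a $K\otimes_k K$-module) that is finite-dimensional as a left $K$-vector space; its rank $[W]$ is its class in the Grothendieck group $K_0$ of the category of two-sided vector spaces. Let $V$ be a two-sided vector space with $[V]=l_1[S_1]+\dots+l_r[S_r]$, where $S_1,\dots,S_r$ are pairwise non-isomorphic simple two-sided vector spaces. Put $m_i=\dim_K S_i$, let $V_i\subseteq V$ be the $S_i$-homogeneous summand (the largest two-sided subspace all of whose simple subquotients are isomorphic to $S_i$), and let $\phi_i:K\to \mathrm{End}({}_KV_i)$ be given by the right action of $K$ on $V_i$. For a finite-dimensional $K$-vector space $U$, a set $A\subseteq \mathrm{End}_K(U)$ and an integer $m\ge 0$, define functors from commutative $K$-algebras to sets, with pullback on morphisms: $G(m,U)(R)$ is the set of free rank $m$ direct summands $M$ of $R\otimes_K U$; $F_A(m,U)(R)$ is the set of $M\in G(m,U)(R)$ that are $A$-invariant; $G_A(m,U)(R)$ is the set of $M\in G(m,U)(R)$ such that the image of $\bigwedge^m M$ in $\bigwedge^m(R\otimes_K U)\cong R\otimes_K\bigwedge^m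 U$ has a generator of the form $\sum_i r_i\otimes v_{i1}\wedge\dots\wedge v_{im}$ where, for each $i$, $v_{i1},\dots,v_{im}$ is a basis of an $A$-invariant subspace of $U$; and $H_A(m,U)=F_A(m,U)\cap G_A(m,U)$. For a class $\xi=q_1[S_1]+\dots+q_r[S_r]$ with $q_i\in\mathbb{Z}_{\ge0}$, put $F_\phi(\xi,V)=\prod_i F_{\operatorname{im}\phi_i}(q_im_i,V_i)$, and define $G_\phi(\xi,V)$ and $H_\phi(\xi,V)$ in the same way from $G_{\operatorname{im}\phi_i}$ and $H_{\operatorname{im}\phi_i}$; if $\xi$ is not of this form, all three are the empty functor. Let $\mathbb{G}(q,l)$ be the Grassmannian scheme over $\operatorname{Spec}K$, whose $R$-points are the direct summands of $R^{l}$ that are locally free of rank $q$, and let $\mathbb{F}_\phi(\xi,V)$ be the scheme over $\operatorname{Spec} K$ representing the functor defined as $F_\phi(\xi,V)$ but with "locally free of rank $q_im_i$" in place of "free of rank $q_im_i$". Then: (1) for every two-sided vector space $W$, $F_\phi([W],V)=G_\phi([W],V)=H_\phi([W],V)$ as functors; (2) for all integers $q_1,\dots,q_r\ge 0$, $$\mathbb{F}_\phi(q_1[S_1]+\dots+q_r[S_r],V)\cong\prod_{i=1}^r\mathbb{G}(q_i,l_i)$$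 as schemes over $\operatorname{Spec}K$ (the product being over $\operatorname{Spec}K$). That is, the functor of points defining the left-hand side is naturally isomorphic to $R\mapsto\prod_i\{\text{summands of }R^{l_i}\text{ locally free of rank }q_i\}$, and, the $\mathbb{G}(q_i,l_i)$ being given, a scheme over $\operatorname{Spec}K$ represents it if and only if it is a product of the $\mathbb{G}(q_i,l_i)$. Likewise, with free summands, $F_\phi(q_1[S_1]+\dots+q_r[S_r],V)\cong\prod_i G(q_i,K^{l_i})$ as functors. -/

import Mathlib

open CategoryTheory AlgebraicGeometry
open scoped TensorProduct

universe u v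

namespace TwoSided

/-! ### Submodules of `R ⊗ U` and their pullback along maps of `K`-algebras -/

section Ambient

variable {K : Type u} [Field K] {U : Type u} [AddCommGroup U] [Module K U]

/-- The canonical map `R ⊗ U → T ⊗ U` induced by a homomorphism `f : R → T` of `K`-algebras. -/
noncomputable def extendMap (U : Type u) [AddCommGroup U] [Module K U] {R T : Type u}
    [CommRing R] [Algebra K R] [CommRing T] [Algebra K T] (f : R →ₐ[K] T) :
    R ⊗[K] U →ₗ[K] T ⊗[K] U :=
  LinearMap.rTensor U f.toLinearMap

/-- The pullback of `M ⊆ R ⊗ U` along `f : R → T`: the image of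
`T ⊗_R M → T ⊗_R (R ⊗ U) ≅ T ⊗ U`, that is, the `T`-span of the image of `M` in `T ⊗ U`. -/
noncomputable def pullbackSub {R T : Type u} [CommRing R] [Algebra K R] [CommRing T] [Algebra K T]
    (f : R →ₐ[K] T) (M : Submodule R (R ⊗[K] U)) : Submodule T (T ⊗[K] U) :=
  Submodule.span T (extendMap U f '' M)

theorem extendMap_smul {R T : Type u} [CommRing R] [Algebra K R] [CommRing T] [Algebra K T]
    (f : R →ₐ[K] T) (r : R) (x : R ⊗[K] U) :
    extendMap U f (r • x) = f r • extendMap U f x := by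
  induction x using TensorProduct.induction_on with
  | zero => simp
  | tmul a b => simp [extendMap, TensorProduct.smul_tmul']
  | add x y hx hy => rw [smul_add, map_add, hx, hy, map_add, smul_add]

theorem extendMap_id {R : Type u} [CommRing R] [Algebra K R] (x : R ⊗[K] U) :
    extendMap U (AlgHom.id K R) x = x := by
  have h : (AlgHom.id K R).toLinearMap = LinearMap.id := rfl
  simp [extendMap, h]

theorem extendMap_comp {R T Q : Type u} [CommRing R] [Algebra K R] [CommRing T] [Algebra K T]
    [CommRing Q] [Algebra K Q] (f : R →ₐ[K] T) (g : T →ₐ[K] Q) (x : R ⊗[K] U) :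
    extendMap U (g.comp f) x = extendMap U g (extendMap U f x) := by
  have h : (g.comp f).toLinearMap = g.toLinearMap ∘ₗ f.toLinearMap := rfl
  simp [extendMap, h, LinearMap.rTensor_comp]

theorem pullback_id {R : Type u} [CommRing R] [Algebra K R] (M : Submodule R (R ⊗[K] U)) :
    pullbackSub (AlgHom.id K R) M = M := by
  have h : (extendMap U (AlgHom.id K R) : R ⊗[K] U → R ⊗[K] U) = id := funext extendMap_id
  simp [pullbackSub, h]

theorem pullback_comp {R T Q : Type u} [CommRing R] [Algebra K R] [CommRing T] [Algebra K T]
    [CommRing Q] [Algebra K Q] (f : R →ₐ[K] T) (g : T →ₐ[K] Q) (M : Submodule R (R ⊗[K] U)) :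
    pullbackSub (g.comp f) M = pullbackSub g (pullbackSub f M) := by
  apply le_antisymm
  · refine Submodule.span_le.2 ?_
    rintro _ ⟨x, hx, rfl⟩
    rw [extendMap_comp]
    exact Submodule.subset_span ⟨_, Submodule.subset_span ⟨x, hx, rfl⟩, rfl⟩
  · refine Submodule.span_le.2 ?_
    rintro _ ⟨y, hy, rfl⟩
    induction hy using Submodule.span_induction with
    | mem y hy =>
      obtain ⟨x, hx, rfl⟩ := hy
      rw [← extendMap_comp]
      exact Submodule.subset_span ⟨x, hx, rfl⟩
    | zero => simp
    | add y z _ _ h1 h2 => rw [map_add]; exact add_mem h1 h2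
    | smul t y _ h => rw [extendMap_smul]; exact Submodule.smul_mem _ _ h

/-- The functor sending `R` to the set of families `(M_i)` of submodules `M_i ⊆ R ⊗ U_i`, and a
homomorphism of `K`-algebras to the pullback. -/
noncomputable def submodules {ι : Type} (U : ι → Type u) [∀ i, AddCommGroup (U i)]
    [∀ i, Module K (U i)] : CommAlgCat.{u} K ⥤ Type u where
  obj R := ∀ i, Submodule R (R ⊗[K] U i)
  map f := ↾fun M i => pullbackSub f.hom (M i)
  map_id R := by
    apply ConcreteCategory.hom_ext
    intro M
    funext i
    exact pullback_id (M i)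
  map_comp f g := by
    apply ConcreteCategory.hom_ext
    intro M
    funext i
    exact pullback_comp f.hom g.hom (M i)

end Ambient

/-! ### The conditions on submodules -/

section Conditions

variable {K : Type u} [Field K] {U : Type u} [AddCommGroup U] [Module K U]
variable {R : Type u} [CommRing R] [Algebra K R]

/-- `M` is a free rank `m` direct summand of `R ⊗ U`. -/
def IsFreeSummand (m : ℕ) (M : Submodule R (R ⊗[K] U)) : Prop :=
  (∃ N, IsCompl M N) ∧ Nonempty (Module.Basis (Fin m) R M)

/-- `M` is a direct summand of `R ⊗ U` that is locally free of rank `m`. (A direct summand of the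
finite free module `R ⊗ U` is finite projective, so only the rank at each prime is prescribed.) -/
def IsLocallyFreeSummand (m : ℕ) (M : Submodule R (R ⊗[K] U)) : Prop :=
  (∃ N, IsCompl M N) ∧ ∀ p : PrimeSpectrum R, Module.rankAtStalk (R := R) M p = m

/-- `M ⊆ R ⊗ U` is invariant under a set `A` of `K`-linear endomorphisms of `U`. -/
def IsInvariant (A : Set (Module.End K U)) (M : Submodule R (R ⊗[K] U)) : Prop :=
  ∀ a ∈ A, ∀ x ∈ M, LinearMap.baseChange R a x ∈ M

/-- The elements `1 ⊗ (v_1 ∧ ⋯ ∧ v_m)` of `R ⊗ ⋀^m U ≅ ⋀^m (R ⊗ U)`, where `v_1, …, v_m` is a basis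
of an `A`-invariant subspace of `U`. -/
def invariantWedges (A : Set (Module.End K U)) (m : ℕ) (R : Type u) [CommRing R] [Algebra K R] :
    Set (⋀[R]^m (R ⊗[K] U)) :=
  {ω | ∃ w : Fin m → U, LinearIndependent K w ∧
    (∀ a ∈ A, ∀ x ∈ Submodule.span K (Set.range w), a x ∈ Submodule.span K (Set.range w)) ∧
    ω = exteriorPower.ιMulti R m (fun j => (1 : R) ⊗ₜ[K] w j)}

/-- `M` is generated by `A`-invariants: the image of `⋀^m M` in `⋀^m (R ⊗ U) ≅ R ⊗ ⋀^m U` has a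
generator `∑ r_i ⊗ v_{i1} ∧ ⋯ ∧ v_{im}` where, for every `i`, `v_{i1}, …, v_{im}` is a basis of an
`A`-invariant subspace of `U`. -/
def IsGeneratedByInvariants (A : Set (Module.End K U)) (m : ℕ) (M : Submodule R (R ⊗[K] U)) :
    Prop :=
  ∃ ω ∈ Submodule.span R (invariantWedges A m R),
    LinearMap.range (exteriorPower.map (R := R) (M := M) (N := R ⊗[K] U) m M.subtype) = Submodule.span R {ω}

end Conditions

/-! ### Stability of the conditions under pullback -/

section Stability

variable {K : Type u} [Field K] {U : Type u} [AddCommGroup U] [Module K U]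
variable {R T : Type u} [CommRing R] [Algebra K R] [CommRing T] [Algebra K T]

theorem pullback_summand (f : R →ₐ[K] T) {M : Submodule R (R ⊗[K] U)}
    (hM : ∃ N, IsCompl M N) :
    letI := f.toRingHom.toAlgebra
    (∃ N, IsCompl (pullbackSub f M) N) ∧ Nonempty ((T ⊗[R] M) ≃ₗ[T] pullbackSub f M) := by
  let := f.toRingHom.toAlgebra
  have : IsScalarTower K R T := IsScalarTower.of_algebraMap_eq fun x => (f.commutes x).symm
  obtain ⟨N, hN⟩ := hM
  let e := TensorProduct.AlgebraTensorModule.cancelBaseChange K R T T U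
  let p : R ⊗[K] U →ₗ[R] M := Submodule.projectionOnto M N hN
  let i : T ⊗[R] M →ₗ[T] T ⊗[K] U := e.toLinearMap ∘ₗ M.subtype.baseChange T
  let s : T ⊗[K] U →ₗ[T] T ⊗[R] M := p.baseChange T ∘ₗ e.symm.toLinearMap
  have hs : s ∘ₗ i = LinearMap.id := by
    have h : p ∘ₗ M.subtype = LinearMap.id := by
      ext x
      simp [p]
    have h' : ∀ x : M, p x = x := fun x => LinearMap.congr_fun h x
    ext x
    simp [s, i, h']
  have hs' : ∀ x, s (i x) = x := fun x => LinearMap.congr_fun hs x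
  have hext : ∀ (x : R ⊗[K] U), e ((1 : T) ⊗ₜ[R] x) = extendMap U f x := by
    intro x
    induction x using TensorProduct.induction_on with
    | zero => simp
    | tmul a b =>
      simp only [e, TensorProduct.AlgebraTensorModule.cancelBaseChange_tmul, extendMap,
        LinearMap.rTensor_tmul, Algebra.smul_def, mul_one]
      rfl
    | add x y hx hy => rw [TensorProduct.tmul_add, map_add, hx, hy, map_add]
  have hr : LinearMap.range i = pullbackSub f M := by
    apply le_antisymm
    · rintro _ ⟨x, rfl⟩
      induction x using TensorProduct.induction_on with
      | zero => simp
      | tmul t x =>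
        have : i (t ⊗ₜ[R] x) = t • extendMap U f x := by
          rw [← hext, ← map_smul, TensorProduct.smul_tmul']
          simp [i]
        rw [this]
        exact Submodule.smul_mem _ _ (Submodule.subset_span ⟨x, x.2, rfl⟩)
      | add x y hx hy => rw [map_add]; exact add_mem hx hy
    · refine Submodule.span_le.2 ?_
      rintro _ ⟨x, hx, rfl⟩
      exact ⟨1 ⊗ₜ[R] ⟨x, hx⟩, by rw [← hext]; simp [i]⟩
  refine ⟨⟨LinearMap.ker s, ?_⟩, ?_⟩
  · rw [← hr]
    constructor
    · rw [Submodule.disjoint_def]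
      rintro _ ⟨x, rfl⟩ hx
      rw [LinearMap.mem_ker, hs'] at hx
      rw [hx, map_zero]
    · rw [codisjoint_iff, eq_top_iff]
      intro x _
      have hx : x = i (s x) + (x - i (s x)) := by abel
      rw [hx]
      exact Submodule.add_mem_sup ⟨_, rfl⟩ (by rw [LinearMap.mem_ker, map_sub, hs', sub_self])
  · rw [← hr]
    exact ⟨LinearEquiv.ofInjective i (Function.LeftInverse.injective hs')⟩

theorem IsFreeSummand.pullback (f : R →ₐ[K] T) {m : ℕ} {M : Submodule R (R ⊗[K] U)}
    (hM : IsFreeSummand m M) : IsFreeSummand m (pullbackSub f M) := by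
  let := f.toRingHom.toAlgebra
  obtain ⟨h, ⟨e⟩⟩ := pullback_summand f hM.1
  obtain ⟨b⟩ := hM.2
  exact ⟨h, ⟨(b.baseChange T).map e⟩⟩

theorem IsLocallyFreeSummand.pullback [Module.Finite K U] (f : R →ₐ[K] T) {m : ℕ}
    {M : Submodule R (R ⊗[K] U)} (hM : IsLocallyFreeSummand m M) :
    IsLocallyFreeSummand m (pullbackSub f M) := by
  let := f.toRingHom.toAlgebra
  obtain ⟨h, ⟨e⟩⟩ := pullback_summand f hM.1
  obtain ⟨⟨N, hN⟩, hr⟩ := hM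
  have hp : Function.Surjective (Submodule.projectionOnto M N hN) :=
    LinearMap.range_eq_top.1 (Submodule.range_projectionOnto hN)
  have hl : Submodule.projectionOnto M N hN ∘ₗ M.subtype = LinearMap.id := by
    ext x
    simp
  have : Module.Finite R M := Module.Finite.of_surjective _ hp
  have : Module.Projective R M := Module.Projective.of_split _ _ hl
  refine ⟨h, fun p => ?_⟩
  exact (congrFun (Module.rankAtStalk_eq_of_equiv e) p).symm.trans
    ((Module.rankAtStalk_baseChange p).trans (hr _))

theorem baseChange_extendMap (f : R →ₐ[K] T) (a : Module.End K U) (x : R ⊗[K] U) :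
    LinearMap.baseChange T a (extendMap U f x) = extendMap U f (LinearMap.baseChange R a x) := by
  induction x using TensorProduct.induction_on with
  | zero => simp
  | tmul r y => simp [extendMap]
  | add x y hx hy => simp only [map_add, hx, hy]

theorem IsInvariant.pullback (f : R →ₐ[K] T) {A : Set (Module.End K U)}
    {M : Submodule R (R ⊗[K] U)} (hM : IsInvariant A M) : IsInvariant A (pullbackSub f M) := by
  intro a ha x hx
  induction hx using Submodule.span_induction with
  | mem y hy =>
    obtain ⟨x, hx, rfl⟩ := hy
    rw [baseChange_extendMap]
    exact Submodule.subset_span ⟨_, hM a ha x hx, rfl⟩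
  | zero => simp
  | add y z _ _ h1 h2 => rw [map_add]; exact add_mem h1 h2
  | smul t y _ h => rw [map_smul]; exact Submodule.smul_mem _ _ h

/-- The additive map `⋀^m (R ⊗ U) → ⋀^m (T ⊗ U)` induced by `f : R → T`. -/
theorem exists_wedgeMap (f : R →ₐ[K] T) (m : ℕ) :
    ∃ Φ : ⋀[R]^m (R ⊗[K] U) →+ ⋀[T]^m (T ⊗[K] U),
      (∀ (r : R) ω, Φ (r • ω) = f r • Φ ω) ∧
      ∀ w : Fin m → R ⊗[K] U, Φ (exteriorPower.ιMulti R m w) =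
        exteriorPower.ιMulti T m (fun j => extendMap U f (w j)) := by
  let := f.toRingHom.toAlgebra
  let : Module R (⋀[T]^m (T ⊗[K] U)) := Module.compHom _ f.toRingHom
  let α : (R ⊗[K] U) [⋀^Fin m]→ₗ[R] (⋀[T]^m (T ⊗[K] U)) :=
    { toFun := fun w => exteriorPower.ιMulti T m (fun j => extendMap U f (w j))
      map_update_add' := by
        intro _ w i x y
        have h : ∀ z, (fun j => extendMap U f (Function.update w i z j)) =
            Function.update (fun j => extendMap U f (w j)) i (extendMap U f z) := by
          intro z
          funext j
          by_cases hj : j = i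
          · subst hj; simp
          · simp [hj]
        rw [h, h, h, map_add, AlternatingMap.map_update_add]
      map_update_smul' := by
        intro _ w i r x
        have h : ∀ z, (fun j => extendMap U f (Function.update w i z j)) =
            Function.update (fun j => extendMap U f (w j)) i (extendMap U f z) := by
          intro z
          funext j
          by_cases hj : j = i
          · subst hj; simp
          · simp [hj]
        rw [h, h, extendMap_smul, AlternatingMap.map_update_smul]
        rfl
      map_eq_zero_of_eq' := by
        intro w i j hij hne
        exact AlternatingMap.map_eq_zero_of_eq _ _ (congrArg (extendMap U f) hij) hne }
  refine ⟨(exteriorPower.alternatingMapLinearEquiv α).toAddMonoidHom, ?_, ?_⟩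
  · intro r ω
    exact (exteriorPower.alternatingMapLinearEquiv α).map_smul r ω
  · intro w
    exact exteriorPower.alternatingMapLinearEquiv_apply_ιMulti α w

theorem range_wedge (m : ℕ) (M : Submodule R (R ⊗[K] U)) {s : Set (R ⊗[K] U)}
    (hs : Submodule.span R s = M) :
    LinearMap.range (exteriorPower.map (R := R) (M := M) (N := R ⊗[K] U) m M.subtype) =
      Submodule.span R {ω | ∃ w : Fin m → R ⊗[K] U, (∀ j, w j ∈ s) ∧
        ω = exteriorPower.ιMulti R m w} := by
  have hsM : s ⊆ M := hs ▸ Submodule.subset_span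
  have ht : Submodule.span R (Subtype.val ⁻¹' s : Set M) = ⊤ := by
    apply Submodule.map_injective_of_injective M.injective_subtype
    rw [Submodule.map_span, Submodule.map_subtype_top]
    conv_rhs => rw [← hs]
    congr 1
    ext x
    constructor
    · rintro ⟨y, hy, rfl⟩
      exact hy
    · intro hx
      exact ⟨⟨x, hsM hx⟩, hx, rfl⟩
  rw [LinearMap.range_eq_map, ← exteriorPower.ιMulti_span_of_span R m M ht, Submodule.map_span]
  congr 1
  ext ω
  constructor
  · rintro ⟨_, ⟨w, hw, rfl⟩, rfl⟩
    refine ⟨fun j => (w j : M), fun j => hw ⟨j, rfl⟩, ?_⟩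
    exact exteriorPower.map_apply_ιMulti _ _
  · rintro ⟨w, hw, rfl⟩
    refine ⟨_, ⟨fun j => ⟨w j, hsM (hw j)⟩, ?_, rfl⟩, ?_⟩
    · rintro _ ⟨j, rfl⟩
      exact hw j
    exact exteriorPower.map_apply_ιMulti _ _

theorem IsGeneratedByInvariants.pullback (f : R →ₐ[K] T) {A : Set (Module.End K U)} {m : ℕ}
    {M : Submodule R (R ⊗[K] U)} (hM : IsGeneratedByInvariants A m M) :
    IsGeneratedByInvariants A m (pullbackSub f M) := by
  obtain ⟨ω, hω, hr⟩ := hM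
  obtain ⟨Φ, hΦ, hw⟩ := exists_wedgeMap (U := U) f m
  have hspan : ∀ (s : Set (⋀[R]^m (R ⊗[K] U))) (t : Set (⋀[T]^m (T ⊗[K] U))),
      (∀ x ∈ s, Φ x ∈ Submodule.span T t) →
      ∀ x ∈ Submodule.span R s, Φ x ∈ Submodule.span T t := by
    intro s t h x hx
    induction hx using Submodule.span_induction with
    | mem x hx => exact h x hx
    | zero => simp
    | add x y _ _ h1 h2 => rw [map_add]; exact add_mem h1 h2
    | smul r x _ h => rw [hΦ]; exact Submodule.smul_mem _ _ h
  refine ⟨Φ ω, ?_, ?_⟩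
  · refine hspan _ _ ?_ ω hω
    rintro _ ⟨w, h1, h2, rfl⟩
    refine Submodule.subset_span ⟨w, h1, h2, ?_⟩
    rw [hw]
    congr 1
    funext j
    simp [extendMap]
  · rw [range_wedge m (pullbackSub f M) rfl]
    have h0 := range_wedge m M (s := (M : Set (R ⊗[K] U))) (Submodule.span_eq M)
    rw [hr] at h0
    apply le_antisymm
    · refine Submodule.span_le.2 ?_
      rintro _ ⟨w, hwM, rfl⟩
      choose y hy hyw using hwM
      have : w = fun j => extendMap U f (y j) := funext fun j => (hyw j).symm
      rw [this, ← hw]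
      refine hspan {ω} {Φ ω} ?_ _ ?_
      · rintro _ rfl
        exact Submodule.subset_span rfl
      · rw [h0]
        exact Submodule.subset_span ⟨y, hy, rfl⟩
    · refine Submodule.span_le.2 ?_
      rintro _ rfl
      have hω' : ω ∈ Submodule.span R {ω} := Submodule.subset_span rfl
      rw [h0] at hω'
      refine hspan _ _ ?_ ω hω'
      rintro _ ⟨w, hwM, rfl⟩
      rw [hw]
      exact Submodule.subset_span ⟨_, fun j => ⟨w j, hwM j, rfl⟩, rfl⟩

end Stability

/-! ### Products of the functors `G(m, U)`, `F_A(m, U)`, `G_A(m, U)`, `H_A(m, U)` -/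

section Functors

variable {K : Type u} [Field K] {ι : Type} (m : ι → ℕ)
variable (U : ι → Type u) [∀ i, AddCommGroup (U i)] [∀ i, Module K (U i)]
variable (A : ∀ i, Set (Module.End K (U i)))

/-- `∏ G(m_i, U_i)`: families of free rank `m_i` summands of `R ⊗ U_i`. -/
noncomputable def prodG : Subfunctor (submodules (K := K) U) where
  obj _ := {M | ∀ i, IsFreeSummand (m i) (M i)}
  map f _ hM i := (hM i).pullback f.hom

/-- `∏ F_{A_i}(m_i, U_i)`: families of `A_i`-invariant free rank `m_i` summands of `R ⊗ U_i`. -/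
noncomputable def prodFA : Subfunctor (submodules (K := K) U) where
  obj _ := {M | ∀ i, IsFreeSummand (m i) (M i) ∧ IsInvariant (A i) (M i)}
  map f _ hM i := ⟨(hM i).1.pullback f.hom, (hM i).2.pullback f.hom⟩

/-- `∏ G_{A_i}(m_i, U_i)`: families of free rank `m_i` summands of `R ⊗ U_i` that are generated by
`A_i`-invariants. -/
noncomputable def prodGA : Subfunctor (submodules (K := K) U) where
  obj _ := {M | ∀ i, IsFreeSummand (m i) (M i) ∧ IsGeneratedByInvariants (A i) (m i) (M i)}
  map f _ hM i := ⟨(hM i).1.pullback f.hom, (hM i).2.pullback f.hom⟩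

/-- `∏ H_{A_i}(m_i, U_i)`, where `H_A(m, U)` is the fibre product of `F_A(m, U)` and `G_A(m, U)`
over `G(m, U)`, that is, their intersection. -/
noncomputable def prodHA : Subfunctor (submodules (K := K) U) :=
  prodFA m U A ⊓ prodGA m U A

/-- The functor of points of the product of the Grassmannian schemes `𝔾(m_i, U_i)` over `Spec K`:
families of summands of `R ⊗ U_i` that are locally free of rank `m_i`. -/
noncomputable def prodLocG [∀ i, Module.Finite K (U i)] : Subfunctor (submodules (K := K) U) where
  obj _ := {M | ∀ i, IsLocallyFreeSummand (m i) (M i)}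
  map f _ hM i := (hM i).pullback f.hom

/-- The functor of points of the product of the schemes `𝔽_{A_i}(m_i, U_i)` over `Spec K`:
families of `A_i`-invariant summands of `R ⊗ U_i` that are locally free of rank `m_i`. -/
noncomputable def prodLocFA [∀ i, Module.Finite K (U i)] :
    Subfunctor (submodules (K := K) U) where
  obj _ := {M | ∀ i, IsLocallyFreeSummand (m i) (M i) ∧ IsInvariant (A i) (M i)}
  map f _ hM i := ⟨(hM i).1.pullback f.hom, (hM i).2.pullback f.hom⟩

end Functors

/-! ### Two-sided vector spaces and their rank -/

/-- A two-sided vector space: a `k`-central `K`-`K`-bimodule, i.e. a `K ⊗_k K`-module with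
`(x ⊗ y) v = x v y`, of finite dimension as a left `K`-module. -/
structure TwoSidedSpace (k : Type v) (K : Type u) [Field k] [Field K] [Algebra k K] where
  carrier : Type u
  [addCommGroup : AddCommGroup carrier]
  [leftModule : Module K carrier]
  [bimodule : Module (K ⊗[k] K) carrier]
  [isScalarTower : IsScalarTower K (K ⊗[k] K) carrier]
  [finite : Module.Finite K carrier]

attribute [instance] TwoSidedSpace.addCommGroup TwoSidedSpace.leftModule TwoSidedSpace.bimodule
  TwoSidedSpace.isScalarTower TwoSidedSpace.finite

section Spaces

variable {k : Type v} {K : Type u} [Field k] [Field K] [Algebra k K]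

instance : CoeSort (TwoSidedSpace k K) (Type u) := ⟨TwoSidedSpace.carrier⟩

/-- The ring homomorphism `φ : K → End(_K V)` given by the right action, `φ(x)(v) = v x`. -/
noncomputable def TwoSidedSpace.φ (V : TwoSidedSpace k K) : K →+* Module.End K V :=
  (Algebra.lsmul K K V : K ⊗[k] K →ₐ[K] Module.End K V).toRingHom.comp
    (Algebra.TensorProduct.includeRight : K →ₐ[k] K ⊗[k] K).toRingHom

/-- `im φ`. -/
noncomputable def TwoSidedSpace.imφ (V : TwoSidedSpace k K) : Set (Module.End K V) :=
  Set.range V.φ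

/-- A two-sided subspace, as a two-sided vector space. -/
def TwoSidedSpace.sub (V : TwoSidedSpace k K) (N : Submodule (K ⊗[k] K) V) :
    TwoSidedSpace k K where
  carrier := N
  finite := inferInstanceAs (Module.Finite K (N.restrictScalars K))

variable (k K) in
/-- The relations `[B] = [A] + [C]` for short exact sequences `0 → A → B → C → 0`. -/
def exactRelations : AddSubgroup (FreeAbelianGroup (TwoSidedSpace k K)) :=
  AddSubgroup.closure {x | ∃ (A B C : TwoSidedSpace k K) (f : A →ₗ[K ⊗[k] K] B)
    (g : B →ₗ[K ⊗[k] K] C), Function.Injective f ∧ Function.Exact f g ∧ Function.Surjective g ∧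
    x = FreeAbelianGroup.of B - (FreeAbelianGroup.of A + FreeAbelianGroup.of C)}

variable (k K) in
/-- The Grothendieck group `K_0` of the category of two-sided vector spaces. -/
abbrev K0 : Type (u + 1) := FreeAbelianGroup (TwoSidedSpace k K) ⧸ exactRelations k K

/-- The rank `[W]` of a two-sided vector space: its class in the Grothendieck group. -/
def TwoSidedSpace.rank (W : TwoSidedSpace k K) : K0 k K :=
  QuotientAddGroup.mk (FreeAbelianGroup.of W)

/-- `P ⊆ V` is `S`-homogeneous: every simple subquotient `N' / N` of `P` is isomorphic to `S`. -/
def IsHomogeneous (S V : TwoSidedSpace k K) (P : Submodule (K ⊗[k] K) V) : Prop :=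
  ∀ N N' : Submodule (K ⊗[k] K) V, N' ≤ P → N ⋖ N' →
    Nonempty ((N' ⧸ N.comap N'.subtype) ≃ₗ[K ⊗[k] K] S)

/-- The `S`-homogeneous summand of `V`: its largest `S`-homogeneous two-sided subspace. -/
def TwoSidedSpace.component (V S : TwoSidedSpace k K) : TwoSidedSpace k K :=
  V.sub (sSup {P | IsHomogeneous S V P})

/-! ### The functors `F_φ`, `G_φ`, `H_φ`

Here `S_1, …, S_r` are the simple two-sided vector spaces occurring in `V` and `V_i` is the
`S_i`-homogeneous summand of `V`. If `ξ = q_1 [S_1] + ⋯ + q_r [S_r]` in the Grothendieck group, the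
value at `ξ` is the product of the functors for `im φ_i` on `V_i` in rank `q_i dim S_i` (the `q_i`
are determined by `ξ`, as `S_1, …, S_r` are simple and pairwise non-isomorphic). If `ξ` is not of
this form, the value is the empty functor. -/

variable {r : ℕ} (S : Fin r → TwoSidedSpace k K) (V : TwoSidedSpace k K) (ξ : K0 k K)

/-- The functor `F_φ(ξ, V)`. -/
noncomputable def Fφ : Subfunctor (submodules (K := K) fun i => V.component (S i)) :=
  ⨆ (q : Fin r → ℕ) (_ : ξ = ∑ i, q i • (S i).rank),
    prodFA (fun i => q i * Module.finrank K (S i)) _ fun i => (V.component (S i)).imφ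

/-- The functor `G_φ(ξ, V)`. -/
noncomputable def Gφ : Subfunctor (submodules (K := K) fun i => V.component (S i)) :=
  ⨆ (q : Fin r → ℕ) (_ : ξ = ∑ i, q i • (S i).rank),
    prodGA (fun i => q i * Module.finrank K (S i)) _ fun i => (V.component (S i)).imφ

/-- The functor `H_φ(ξ, V)`. -/
noncomputable def Hφ : Subfunctor (submodules (K := K) fun i => V.component (S i)) :=
  ⨆ (q : Fin r → ℕ) (_ : ξ = ∑ i, q i • (S i).rank),
    prodHA (fun i => q i * Module.finrank K (S i)) _ fun i => (V.component (S i)).imφ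

/-- The functor of points of the scheme `𝔽_φ(ξ, V)`: as `F_φ(ξ, V)`, with locally free summands
in place of free ones. -/
noncomputable def locFφ : Subfunctor (submodules (K := K) fun i => V.component (S i)) :=
  ⨆ (q : Fin r → ℕ) (_ : ξ = ∑ i, q i • (S i).rank),
    prodLocFA (fun i => q i * Module.finrank K (S i)) _ fun i => (V.component (S i)).imφ

end Spaces

/-! ### Schemes over `Spec K` -/

section Schemes

variable {K : Type u} [Field K]

/-- The functor of points `R ↦ Hom_{Spec K}(Spec R, X)` of a scheme `X` over `Spec K`, on
commutative `K`-algebras. -/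
noncomputable def functorOfPoints (X : Over (Spec (CommRingCat.of K))) :
    CommAlgCat.{u} K ⥤ Type u :=
  (algSpec (CommRingCat.of K)).rightOp ⋙ yoneda.obj X

/-- The scheme `X` over `Spec K` represents the functor `F`. -/
def Represents (X : Over (Spec (CommRingCat.of K))) (F : CommAlgCat.{u} K ⥤ Type u) : Prop :=
  Nonempty (functorOfPoints X ≅ F)

/-- `Y` is the Grassmannian scheme `𝔾(m, n)` over `Spec K`: the scheme representing the functor
of summands of `R ^ n ≅ R ⊗ K ^ n` that are locally free of rank `m`. -/
def IsGrassmannian (m n : ℕ) (Y : Over (Spec (CommRingCat.of K))) : Prop :=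
  Represents Y (prodLocG (K := K) (fun _ : Unit => m) fun _ => Fin n → K).toFunctor

/-- `X` is the product of the schemes `Y_i` over `Spec K`. -/
def IsProduct {r : ℕ} (X : Over (Spec (CommRingCat.of K)))
    (Y : Fin r → Over (Spec (CommRingCat.of K))) : Prop :=
  ∃ π : ∀ i, X ⟶ Y i, Nonempty (Limits.IsLimit (Limits.Fan.mk X π))

end Schemes

end TwoSided

open TwoSided

/-! Since $K/k$ is finite Galois, the characters $x\otimes y\mapsto x\sigma(y)$ identify $K\otimes_k
K$ with a product of copies of $K$ indexed by the Galois group (`bijective_characters`): Dedekind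
independence gives surjectivity and a dimension count does the rest. The resulting idempotents split
every two-sided vector space into eigenspaces `part V σ`. A simple one is therefore a line with a
single character, and its homogeneous component in $V$ is the corresponding eigenspace
(`component_eq`), on which $K$ acts on the right by the scalars $\sigma(x)$.

Scalars preserve every submodule, and every pure wedge of basis vectors comes from an invariant
subspace, so both invariance and generation by invariants hold for all free summands. Hence $F$, $G$
and $H$ all equal the plain product of Grassmannian functors. Eigenspace dimension is additive on
exact sequences, so it descends to $K_0$ (`multiplicity`); it shows that a class determines its
coefficients $q_i$ and that $\dim V_i=l_i$. Choosing bases of the $V_i$ gives the isomorphisms of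
functors.

For schemes, the functor of points on $K$-algebras is fully faithful, morphisms being glued over
affine opens. An objectwise product of represented functors is thus represented exactly by the
products of the representing schemes (`represents_iff_isProduct`). -/

namespace TwoSided

/-! ### Full faithfulness of the functor of points on algebras -/

section FunctorOfPoints

variable {K : Type u} [Field K]

/-- The functor of points, as a functor in the scheme. -/
noncomputable def pointsFunctor (K : Type u) [Field K] :
    Over (Spec (CommRingCat.of K)) ⥤ CommAlgCat.{u} K ⥤ Type u :=
  yoneda ⋙ (Functor.whiskeringLeft _ _ _).obj (algSpec (CommRingCat.of K)).rightOp

/-- The spectrum of a `K`-algebra, as a scheme over `Spec K`. -/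
noncomputable abbrev specOver (R : CommAlgCat.{u} K) : Over (Spec (CommRingCat.of K)) :=
  (algSpec (CommRingCat.of K)).obj (Opposite.op R)

/-- Every affine scheme over `Spec K` is the spectrum of a `K`-algebra. -/
theorem exists_specOver_iso (T : Over (Spec (CommRingCat.of K))) (hT : IsAffine T.left) :
    ∃ R : CommAlgCat.{u} K, Nonempty (specOver R ≅ T) := by
  let f : CommRingCat.of K ⟶ Γ(T.left, ⊤) := Spec.preimage (T.left.isoSpec.inv ≫ T.hom)
  let : Algebra K Γ(T.left, ⊤) := f.hom.toAlgebra
  refine ⟨CommAlgCat.of K Γ(T.left, ⊤), ⟨Over.isoMk T.left.isoSpec.symm ?_⟩⟩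
  exact (Spec.map_preimage _).symm

/-- The algebra of functions of an affine scheme over `Spec K`. -/
noncomputable def affineAlgebra (T : Over (Spec (CommRingCat.of K))) (hT : IsAffine T.left) :
    CommAlgCat.{u} K :=
  (exists_specOver_iso T hT).choose

/-- An affine scheme over `Spec K` is the spectrum of its algebra of functions. -/
noncomputable def affineIso (T : Over (Spec (CommRingCat.of K))) (hT : IsAffine T.left) :
    specOver (affineAlgebra T hT) ≅ T :=
  (exists_specOver_iso T hT).choose_spec.some

variable {X Y : Over (Spec (CommRingCat.of K))}

/-- A natural transformation between functors of points, evaluated at an algebra. -/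
noncomputable def specApp (α : functorOfPoints X ⟶ functorOfPoints Y) (R : CommAlgCat.{u} K)
    (x : specOver R ⟶ X) : specOver R ⟶ Y :=
  α.app R x

theorem specApp_comp (α : functorOfPoints X ⟶ functorOfPoints Y) {R R' : CommAlgCat.{u} K}
    (h : specOver R' ⟶ specOver R) (x : specOver R ⟶ X) :
    specApp α R' (h ≫ x) = h ≫ specApp α R x := by
  obtain ⟨f, rfl⟩ := (algSpec.fullyFaithful (R := CommRingCat.of K)).map_surjective h
  exact ConcreteCategory.congr_hom (α.naturality f.unop) x

/-- A natural transformation between functors of points, evaluated at an affine scheme. -/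
noncomputable def affineApp (α : functorOfPoints X ⟶ functorOfPoints Y)
    (T : Over (Spec (CommRingCat.of K))) (hT : IsAffine T.left) (x : T ⟶ X) : T ⟶ Y :=
  (affineIso T hT).inv ≫ specApp α (affineAlgebra T hT) ((affineIso T hT).hom ≫ x)

/-- The isomorphisms `affineIso` are arbitrary choices; naturality holds because a map of affine
schemes, conjugated by them, becomes a map of spectra. -/
theorem affineApp_comp (α : functorOfPoints X ⟶ functorOfPoints Y)
    {T T' : Over (Spec (CommRingCat.of K))} (hT : IsAffine T.left) (hT' : IsAffine T'.left)
    (h : T' ⟶ T) (x : T ⟶ X) : affineApp α T' hT' (h ≫ x) = h ≫ affineApp α T hT x := by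
  have := specApp_comp α ((affineIso T' hT').hom ≫ h ≫ (affineIso T hT).inv)
    ((affineIso T hT).hom ≫ x)
  simp only [Category.assoc, Iso.inv_hom_id_assoc] at this
  simp only [affineApp]
  rw [this]
  simp

theorem affineApp_specOver (α : functorOfPoints X ⟶ functorOfPoints Y) (R : CommAlgCat.{u} K)
    (hR : IsAffine (specOver R).left) (x : specOver R ⟶ X) :
    affineApp α _ hR x = specApp α R x := by
  rw [affineApp, specApp_comp, Iso.inv_hom_id_assoc]

/-- Morphisms over `Spec K` agree if they agree on all affine schemes that map to a given open
cover of the source. -/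
theorem over_hom_ext (𝒰 : X.left.OpenCover) {f g : X ⟶ Y}
    (h : ∀ (T : Over (Spec (CommRingCat.of K))) (_ : IsAffine T.left) (x : T ⟶ X) (i : 𝒰.I₀)
      (y : T.left ⟶ 𝒰.X i), x.left = y ≫ 𝒰.f i → x ≫ f = x ≫ g) :
    f = g := by
  ext1
  -- The members of the cover need not be affine, so each is covered again by affines, which serve
  -- as test objects.
  refine 𝒰.hom_ext _ _ fun i => (𝒰.X i).affineCover.hom_ext _ _ fun j => ?_
  have := h (Over.mk ((𝒰.X i).affineCover.f j ≫ 𝒰.f i ≫ X.hom))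
    (inferInstanceAs (IsAffine ((𝒰.X i).affineCover.X j)))
    (Over.homMk ((𝒰.X i).affineCover.f j ≫ 𝒰.f i)) i ((𝒰.X i).affineCover.f j) rfl
  simpa using congrArg (fun t => t.left) this

/-- A natural transformation between functors of points is induced by a morphism. -/
theorem exists_hom_of_natTrans (α : functorOfPoints X ⟶ functorOfPoints Y) :
    ∃ F : X ⟶ Y, ∀ (T : Over (Spec (CommRingCat.of K))) (hT : IsAffine T.left) (x : T ⟶ X),
      x ≫ F = affineApp α T hT x := by
  -- This cover consists of all affine opens, directed by inclusion. Gluing then needs compatibility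
  -- along inclusions only, so intersections, which may fail to be affine, never enter.
  let 𝒰 := X.left.directedAffineCover
  have h𝒰 : ∀ U, IsAffine (𝒰.X U) := fun U => U.2
  let T : 𝒰.I₀ → Over (Spec (CommRingCat.of K)) := fun U => Over.mk (𝒰.f U ≫ X.hom)
  have hT : ∀ U, IsAffine (T U).left := h𝒰
  let t : ∀ U, T U ⟶ X := fun U => Over.homMk (𝒰.f U)
  let F : X ⟶ Y := 𝒰.glueMorphismsOverOfLocallyDirected
    (fun U => (affineApp α (T U) (hT U) (t U)).left)
    (by
      intro U U' hU
      have hc := Scheme.Cover.trans_map 𝒰 hU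
      let s : T U ⟶ T U' := Over.homMk (Scheme.Cover.trans 𝒰 hU) 
        ((Category.assoc _ _ _).symm.trans (congrArg (· ≫ X.hom) hc))
      have hs : s ≫ t U' = t U := by
        ext1
        exact hc
      have := affineApp_comp α (hT U') (hT U) s (t U')
      rw [hs] at this
      rw [this]
      rfl)
    (fun U => Over.w _)
  have hF : ∀ U, t U ≫ F = affineApp α (T U) (hT U) (t U) := by
    intro U
    ext1
    exact 𝒰.map_glueMorphismsOverOfLocallyDirected_left _ _ _ U
  refine ⟨F, fun Z hZ x => ?_⟩
  -- The image of `x` need not lie in one affine open. After pulling the cover back along `x`, each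
  -- test map factors through some `T U`, where the value of `F` is known.
  refine over_hom_ext (𝒰.pullback₁ x.left) fun W hW y (U : 𝒰.I₀)
    (z : W.left ⟶ Limits.pullback x.left (𝒰.f U)) hyz => ?_
  have h1 : z ≫ Limits.pullback.fst x.left (𝒰.f U) = y.left := hyz.symm
  have h2 : (z ≫ Limits.pullback.snd x.left (𝒰.f U)) ≫ 𝒰.f U = y.left ≫ x.left := by
    rw [Category.assoc, ← Limits.pullback.condition, reassoc_of% h1]
  let w : W ⟶ T U := Over.homMk (z ≫ Limits.pullback.snd x.left (𝒰.f U))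
    ((Category.assoc _ _ _).symm.trans ((congrArg (· ≫ X.hom) h2).trans (by simp)))
  have hw : w ≫ t U = y ≫ x := by
    ext1
    exact h2
  rw [← Category.assoc, ← hw, Category.assoc, hF, ← affineApp_comp α (hT U) hW, hw,
    affineApp_comp α hZ hW]

instance : (pointsFunctor K).Full where
  map_surjective {X Y} α := by
    obtain ⟨F, hF⟩ := exists_hom_of_natTrans (X := X) (Y := Y) α
    refine ⟨F, ?_⟩
    ext R x
    exact (hF (specOver R) (inferInstanceAs (IsAffine (Spec _))) x).trans
      (affineApp_specOver (X := X) (Y := Y) α R _ x)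

instance : (pointsFunctor K).Faithful where
  map_injective {X Y f g} h := by
    refine over_hom_ext (X := X) (Y := Y) X.left.affineCover fun T hT x _ _ _ => ?_
    have h2 : ((affineIso T hT).hom ≫ x) ≫ f = ((affineIso T hT).hom ≫ x) ≫ g :=
      congrArg (fun α : functorOfPoints X ⟶ functorOfPoints Y =>
        specApp α (affineAlgebra T hT) ((affineIso T hT).hom ≫ x)) h
    simpa using h2

end FunctorOfPoints

/-! ### Products of functors and products of schemes -/

section Representability

variable {K : Type u} [Field K]

/-- The existence half of the universal property of a product: the objectwise inverse is natural
because this can be tested after each projection. -/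
theorem exists_natTrans_of_bijective {r : ℕ} {F : CommAlgCat.{u} K ⥤ Type u}
    {G : Fin r → CommAlgCat.{u} K ⥤ Type u} (p : ∀ i, F ⟶ G i)
    (hp : ∀ R, Function.Bijective fun (x : F.obj R) i => (p i).app R x)
    {H : CommAlgCat.{u} K ⥤ Type u} (s : ∀ i, H ⟶ G i) : ∃ t : H ⟶ F, ∀ i, t ≫ p i = s i := by
  let e := fun R => Equiv.ofBijective _ (hp R)
  have he : ∀ R y i, (p i).app R ((e R).symm y) = y i := fun R y i =>
    congrFun ((e R).apply_symm_apply y) i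
  refine ⟨{ app := fun R => ↾fun x => (e R).symm fun i => (s i).app R x, naturality := ?_ }, ?_⟩
  · intro R R' f
    ext x
    apply (hp R').1
    funext i
    have h1 := ConcreteCategory.congr_hom ((p i).naturality f) ((e R).symm fun i => (s i).app R x)
    have h2 := ConcreteCategory.congr_hom ((s i).naturality f) x
    have h3 := he R (fun i => (s i).app R x) i
    have h4 := he R' (fun i => (s i).app R' (H.map f x)) i
    simp only [ConcreteCategory.comp_apply] at h1 h2
    exact h4.trans (h2.trans ((congrArg _ h3).symm.trans h1.symm))
  · intro i
    ext R x
    exact he R _ i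

theorem natTrans_ext_of_injective {r : ℕ} {F : CommAlgCat.{u} K ⥤ Type u}
    {G : Fin r → CommAlgCat.{u} K ⥤ Type u} (p : ∀ i, F ⟶ G i)
    (hp : ∀ R, Function.Injective fun (x : F.obj R) i => (p i).app R x)
    {H : CommAlgCat.{u} K ⥤ Type u} {s t : H ⟶ F} (h : ∀ i, s ≫ p i = t ≫ p i) : s = t := by
  ext R x
  apply hp R
  funext i
  exact ConcreteCategory.congr_hom (NatTrans.congr_app (h i) R) x

/-- A scheme over `Spec K` represents a product of representable functors if and only if it is a
product of the representing schemes. -/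
theorem represents_iff_isProduct {r : ℕ} {F : CommAlgCat.{u} K ⥤ Type u}
    {G : Fin r → CommAlgCat.{u} K ⥤ Type u} (p : ∀ i, F ⟶ G i)
    (hp : ∀ R, Function.Bijective fun (x : F.obj R) i => (p i).app R x)
    {Y : Fin r → Over (Spec (CommRingCat.of K))} (hY : ∀ i, Represents (Y i) (G i))
    (X : Over (Spec (CommRingCat.of K))) : Represents X F ↔ IsProduct X Y := by
  let e := fun i => (hY i).some
  let N := pointsFunctor K
  let e' : ∀ i, N.obj (Y i) ≅ G i := e
  constructor
  · rintro ⟨a⟩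
    let a' : N.obj X ≅ F := a
    let π : ∀ i, X ⟶ Y i := fun i => N.preimage (a'.hom ≫ p i ≫ (e' i).inv)
    have hπ : ∀ i, N.map (π i) = a'.hom ≫ p i ≫ (e' i).inv := fun i => N.map_preimage _
    have ha : ∀ i, p i = a'.inv ≫ N.map (π i) ≫ (e' i).hom := fun i => by
      rw [hπ]; simp
    refine ⟨π, ⟨Limits.Fan.IsLimit.mk _
      (fun s => N.preimage ((exists_natTrans_of_bijective p hp
        fun i => N.map (s.proj i) ≫ (e' i).hom).choose ≫ a'.inv)) ?_ ?_⟩⟩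
    · intro s i
      have h := (exists_natTrans_of_bijective p hp
        fun i => N.map (s.proj i) ≫ (e' i).hom).choose_spec i
      apply N.map_injective
      rw [N.map_comp, N.map_preimage]
      have h3 : N.map ((Limits.Fan.mk X π).proj i) = a'.hom ≫ p i ≫ (e' i).inv := hπ i
      rw [h3, Category.assoc, Iso.inv_hom_id_assoc, reassoc_of% h, Iso.hom_inv_id,
        Category.comp_id]
    · intro s m hm
      apply N.map_injective
      rw [N.map_preimage, ← cancel_mono a'.hom, Category.assoc, Iso.inv_hom_id, Category.comp_id]
      refine natTrans_ext_of_injective p (fun R => (hp R).1) fun i => ?_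
      rw [(exists_natTrans_of_bijective p hp
        fun i => N.map (s.proj i) ≫ (e' i).hom).choose_spec i, ← hm i, N.map_comp]
      have h3 : N.map ((Limits.Fan.mk X π).proj i) = a'.hom ≫ p i ≫ (e' i).inv := hπ i
      rw [h3]
      simp
  · rintro ⟨π, ⟨L⟩⟩
    obtain ⟨t, ht⟩ := exists_natTrans_of_bijective p hp fun i => N.map (π i) ≫ (e' i).hom
    have hb : ∀ R, Function.Bijective (t.app R) := by
      intro R
      -- Followed by the bijection `hp R`, the map becomes `x ↦ (x ≫ π i)` up to the isomorphisms
      -- `e' i`, and this is bijective by the universal property of `X` tested on `specOver R`.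
      have hc : (fun (x : F.obj R) i => (p i).app R x) ∘ (t.app R) =
          fun (x : specOver R ⟶ X) i => (e' i).hom.app R (x ≫ π i) := by
        funext x i
        exact ConcreteCategory.congr_hom (NatTrans.congr_app (ht i) R) x
      refine (Function.Bijective.of_comp_iff' (hp R) _).1 ?_
      rw [hc]
      have he : ∀ i, Function.Bijective ((e' i).hom.app R) := fun i =>
        (isIso_iff_bijective _).1 inferInstance
      constructor
      · intro x y hxy
        refine Limits.Fan.IsLimit.hom_ext L _ _ fun i => ?_
        exact (he i).1 (congrFun hxy i)
      · intro y
        choose z hz using fun i => (he i).2 (y i)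
        refine ⟨Limits.Fan.IsLimit.lift L z, ?_⟩
        funext i
        rw [← hz i]
        exact congrArg _ (Limits.Fan.IsLimit.fac L z i)
    have : ∀ R, IsIso (t.app R) := fun R => (isIso_iff_bijective _).2 (hb R)
    have : IsIso t := NatIso.isIso_of_isIso_app t
    let a : N.obj X ≅ F := asIso t
    exact ⟨a⟩

end Representability

/-! ### Scalar endomorphisms impose no condition on summands -/

section Scalars

variable {K : Type u} [Field K] {U : Type u} [AddCommGroup U] [Module K U]
variable {R : Type u} [CommRing R] [Algebra K R]

/-- A set of endomorphisms that are multiplications by scalars. -/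
def IsScalarSet (A : Set (Module.End K U)) : Prop :=
  ∀ a ∈ A, ∃ c : K, ∀ x, a x = c • x

theorem IsScalarSet.isInvariant {A : Set (Module.End K U)} (hA : IsScalarSet A)
    (M : Submodule R (R ⊗[K] U)) : IsInvariant A M := by
  intro a ha x hx
  obtain ⟨c, hc⟩ := hA a ha
  have h : a = c • LinearMap.id := LinearMap.ext hc
  have h' : LinearMap.baseChange R a x = algebraMap K R c • x := by
    rw [h, LinearMap.baseChange_smul, LinearMap.baseChange_id, LinearMap.smul_apply,
      LinearMap.id_apply, algebraMap_smul]
  rw [h']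
  exact M.smul_mem _ hx

/-- Wedges of vectors from a $K$-basis of $U$ generate the exterior power. Those with a repeated
vector vanish; the others come from subspaces that scalars preserve. -/
theorem IsScalarSet.span_invariantWedges {A : Set (Module.End K U)} (hA : IsScalarSet A) (m : ℕ) :
    Submodule.span R (invariantWedges A m R) = ⊤ := by
  let b := Module.Basis.ofVectorSpace K U
  rw [eq_top_iff, ← exteriorPower.ιMulti_span_of_span R m (R ⊗[K] U)
    (s := Set.range (b.baseChange R)) (b.baseChange R).span_eq, Submodule.span_le]
  rintro _ ⟨w, hw, rfl⟩
  choose f hf using fun j => hw ⟨j, rfl⟩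
  by_cases hinj : Function.Injective f
  · refine Submodule.subset_span ⟨fun j => b (f j), b.linearIndependent.comp f hinj, ?_, ?_⟩
    · intro a ha x hx
      obtain ⟨c, hc⟩ := hA a ha
      rw [hc]
      exact Submodule.smul_mem _ _ hx
    · congr 1
      funext j
      rw [← hf j, Module.Basis.baseChange_apply]
  · obtain ⟨i, j, hij, hne⟩ : ∃ i j, f i = f j ∧ i ≠ j := by
      simpa [Function.Injective] using hinj
    have : exteriorPower.ιMulti R m w = 0 :=
      AlternatingMap.map_eq_zero_of_eq _ _ (by rw [← hf i, ← hf j, hij]) hne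
    rw [this]
    exact zero_mem _

/-- A wedge of $m$ members of a basis of size $m$ is either zero or, after a permutation, plus or
minus the wedge of the whole basis. -/
theorem range_wedge_of_basis {m : ℕ} {M : Submodule R (R ⊗[K] U)} (b : Module.Basis (Fin m) R M) :
    LinearMap.range (exteriorPower.map (R := R) (M := M) (N := R ⊗[K] U) m M.subtype) =
      Submodule.span R {exteriorPower.ιMulti R m fun j => (b j : R ⊗[K] U)} := by
  have hs : Submodule.span R (Set.range fun j => (b j : R ⊗[K] U)) = M := by
    have : (Set.range fun j => (b j : R ⊗[K] U)) = M.subtype '' Set.range b := by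
      rw [← Set.range_comp]
      rfl
    rw [this, ← Submodule.map_span, b.span_eq, Submodule.map_subtype_top]
  rw [range_wedge m M hs]
  apply le_antisymm
  · refine Submodule.span_le.2 ?_
    rintro _ ⟨w, hw, rfl⟩
    choose f hf using hw
    obtain rfl : (fun j => (b (f j) : R ⊗[K] U)) = w := funext hf
    by_cases hinj : Function.Injective f
    · let σ := Equiv.ofBijective f (Finite.injective_iff_bijective.1 hinj)
      have h := (exteriorPower.ιMulti R m (M := R ⊗[K] U)).map_perm
        (fun j => (b j : R ⊗[K] U)) σ
      have h' : exteriorPower.ιMulti R m (fun j => (b (f j) : R ⊗[K] U)) =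
          Equiv.Perm.sign σ • exteriorPower.ιMulti R m fun j => (b j : R ⊗[K] U) := h
      rw [h']
      have h1 : (exteriorPower.ιMulti R m fun j => (b j : R ⊗[K] U)) ∈
          Submodule.span R {exteriorPower.ιMulti R m fun j => (b j : R ⊗[K] U)} :=
        Submodule.subset_span rfl
      rcases Int.units_eq_one_or (Equiv.Perm.sign σ) with hs | hs
      · rw [hs, one_smul]
        exact h1
      · rw [hs, Units.neg_smul, one_smul]
        exact neg_mem h1
    · obtain ⟨i, j, hij, hne⟩ : ∃ i j, f i = f j ∧ i ≠ j := by
        simpa [Function.Injective] using hinj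
      have : exteriorPower.ιMulti R m (fun j => (b (f j) : R ⊗[K] U)) = 0 :=
        AlternatingMap.map_eq_zero_of_eq _ _ (by rw [hij]) hne
      rw [this]
      exact zero_mem _
  · refine Submodule.span_mono ?_
    rintro _ rfl
    exact ⟨_, fun j => ⟨j, rfl⟩, rfl⟩

theorem IsScalarSet.isGeneratedByInvariants {A : Set (Module.End K U)} (hA : IsScalarSet A)
    {m : ℕ} {M : Submodule R (R ⊗[K] U)} (hM : IsFreeSummand m M) :
    IsGeneratedByInvariants A m M := by
  obtain ⟨b⟩ := hM.2
  exact ⟨_, by rw [hA.span_invariantWedges]; trivial, range_wedge_of_basis b⟩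

end Scalars

/-! ### Change of the ambient vector spaces -/

section Transport

variable {K : Type u} [Field K]

section
variable {U U' : Type u} [AddCommGroup U] [Module K U] [AddCommGroup U'] [Module K U']
variable {R T : Type u} [CommRing R] [Algebra K R] [CommRing T] [Algebra K T]

theorem isFreeSummand_map (e : (R ⊗[K] U) ≃ₗ[R] (R ⊗[K] U')) {m : ℕ}
    {M : Submodule R (R ⊗[K] U)} (hM : IsFreeSummand m M) :
    IsFreeSummand m (M.map (e : R ⊗[K] U →ₗ[R] R ⊗[K] U')) := by
  obtain ⟨⟨N, hN⟩, ⟨b⟩⟩ := hM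
  exact ⟨⟨_, (Submodule.orderIsoMapComap e).isCompl hN⟩, ⟨b.map (e.submoduleMap M)⟩⟩

theorem isLocallyFreeSummand_map (e : (R ⊗[K] U) ≃ₗ[R] (R ⊗[K] U')) {m : ℕ}
    {M : Submodule R (R ⊗[K] U)} (hM : IsLocallyFreeSummand m M) :
    IsLocallyFreeSummand m (M.map (e : R ⊗[K] U →ₗ[R] R ⊗[K] U')) := by
  obtain ⟨⟨N, hN⟩, h⟩ := hM
  exact ⟨⟨_, (Submodule.orderIsoMapComap e).isCompl hN⟩,
    fun p => (congrFun (Module.rankAtStalk_eq_of_equiv (e.submoduleMap M)) p).symm.trans (h p)⟩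

theorem extendMap_baseChange (e : U →ₗ[K] U') (f : R →ₐ[K] T) (x : R ⊗[K] U) :
    e.baseChange T (extendMap U f x) = extendMap U' f (e.baseChange R x) := by
  induction x using TensorProduct.induction_on with
  | zero => simp
  | tmul r y => simp [extendMap]
  | add x y hx hy => simp only [map_add, hx, hy]

/-- Extension of scalars commutes with base changes of $K$-linear maps; this is the naturality
needed to transport the functors along isomorphisms of vector spaces. -/
theorem map_pullbackSub (e : U →ₗ[K] U') (f : R →ₐ[K] T) (M : Submodule R (R ⊗[K] U)) :
    (pullbackSub f M).map (e.baseChange T) = pullbackSub f (M.map (e.baseChange R)) := by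
  rw [pullbackSub, pullbackSub, Submodule.map_span, Set.image_image, Submodule.map_coe,
    Set.image_image]
  simp only [extendMap_baseChange]

end

variable {ι : Type} {U U' : ι → Type u} [∀ i, AddCommGroup (U i)] [∀ i, Module K (U i)]
  [∀ i, AddCommGroup (U' i)] [∀ i, Module K (U' i)]

/-- The map on families of submodules induced by isomorphisms of vector spaces. -/
noncomputable def submodulesMap (e : ∀ i, U i ≃ₗ[K] U' i) (R : Type u) [CommRing R] [Algebra K R]
    (M : ∀ i, Submodule R (R ⊗[K] U i)) : ∀ i, Submodule R (R ⊗[K] U' i) :=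
  fun i => (M i).map ((e i).toLinearMap.baseChange R)

theorem submodulesMap_symm (e : ∀ i, U i ≃ₗ[K] U' i) (R : Type u) [CommRing R] [Algebra K R]
    (M : ∀ i, Submodule R (R ⊗[K] U i)) :
    submodulesMap (fun i => (e i).symm) R (submodulesMap e R M) = M := by
  funext i
  simp only [submodulesMap]
  rw [← Submodule.map_comp, ← LinearMap.baseChange_comp]
  have : (e i).symm.toLinearMap ∘ₗ (e i).toLinearMap = LinearMap.id := by ext; simp
  rw [this, LinearMap.baseChange_id, Submodule.map_id]

theorem subfunctor_iso_of_equiv (e : ∀ i, U i ≃ₗ[K] U' i) (F : Subfunctor (submodules (K := K) U))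
    (G : Subfunctor (submodules (K := K) U'))
    (h : ∀ (R : CommAlgCat.{u} K) (M : ∀ i, Submodule R (R ⊗[K] U i)),
      M ∈ F.obj R → submodulesMap e R M ∈ G.obj R)
    (h' : ∀ (R : CommAlgCat.{u} K) (M : ∀ i, Submodule R (R ⊗[K] U' i)),
      M ∈ G.obj R → submodulesMap (fun i => (e i).symm) R M ∈ F.obj R) :
    Nonempty (F.toFunctor ≅ G.toFunctor) := by
  refine ⟨NatIso.ofComponents (fun R => Equiv.toIso
    { toFun := fun M => ⟨submodulesMap e R M.1, h R _ M.2⟩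
      invFun := fun M => ⟨submodulesMap (fun i => (e i).symm) R M.1, h' R _ M.2⟩
      left_inv := fun M => Subtype.ext (submodulesMap_symm e R M.1)
      right_inv := fun M => Subtype.ext (submodulesMap_symm (fun i => (e i).symm) R M.1) }) ?_⟩
  intro R T f
  ext M
  apply Subtype.ext
  funext i
  exact map_pullbackSub (e i).toLinearMap f.hom (M.1 i)

theorem prodG_iso_of_equiv (e : ∀ i, U i ≃ₗ[K] U' i) (m : ι → ℕ) :
    Nonempty ((prodG (K := K) m U).toFunctor ≅ (prodG (K := K) m U').toFunctor) :=
  subfunctor_iso_of_equiv e _ _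
    (fun R _ hM i => isFreeSummand_map ((e i).baseChange K R _ _) (hM i))
    (fun R _ hM i => isFreeSummand_map ((e i).symm.baseChange K R _ _) (hM i))

theorem prodLocG_iso_of_equiv [∀ i, Module.Finite K (U i)] [∀ i, Module.Finite K (U' i)]
    (e : ∀ i, U i ≃ₗ[K] U' i) (m : ι → ℕ) :
    Nonempty ((prodLocG (K := K) m U).toFunctor ≅ (prodLocG (K := K) m U').toFunctor) :=
  subfunctor_iso_of_equiv e _ _
    (fun R _ hM i => isLocallyFreeSummand_map ((e i).baseChange K R _ _) (hM i))
    (fun R _ hM i => isLocallyFreeSummand_map ((e i).symm.baseChange K R _ _) (hM i))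

/-- The projection of a product of Grassmannian functors to a factor. -/
noncomputable def prodLocGProj (m : ι → ℕ) (U : ι → Type u) [∀ i, AddCommGroup (U i)]
    [∀ i, Module K (U i)] [∀ i, Module.Finite K (U i)] (i : ι) :
    (prodLocG (K := K) m U).toFunctor ⟶
      (prodLocG (K := K) (fun _ : Unit => m i) fun _ => U i).toFunctor where
  app _ := ↾fun M => ⟨fun _ => M.1 i, fun _ => M.2 i⟩
  naturality _ _ _ := rfl

theorem bijective_prodLocGProj (m : ι → ℕ) [∀ i, Module.Finite K (U i)] (R : CommAlgCat.{u} K) :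
    Function.Bijective fun (M : (prodLocG (K := K) m U).toFunctor.obj R) i =>
      (prodLocGProj m U i).app R M := by
  constructor
  · intro M N h
    apply Subtype.ext
    funext i
    exact congrFun (congrArg Subtype.val (congrFun h i)) ()
  · intro N
    exact ⟨⟨fun i => (N i).1 (), fun i => (N i).2 ()⟩, rfl⟩

theorem represents_prodLocG_iff {r : ℕ} (q l : Fin r → ℕ)
    {Y : Fin r → Over (Spec (CommRingCat.of K))} (hY : ∀ i, IsGrassmannian (q i) (l i) (Y i))
    (X : Over (Spec (CommRingCat.of K))) :
    Represents X (prodLocG (K := K) q fun i => Fin (l i) → K).toFunctor ↔ IsProduct X Y :=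
  represents_iff_isProduct (prodLocGProj q _) (bijective_prodLocGProj q) hY X

theorem represents_congr {F G : CommAlgCat.{u} K ⥤ Type u} (e : F ≅ G)
    (X : Over (Spec (CommRingCat.of K))) : Represents X F ↔ Represents X G :=
  ⟨fun ⟨a⟩ => ⟨a ≪≫ e⟩, fun ⟨a⟩ => ⟨a ≪≫ e.symm⟩⟩

end Transport

/-! ### Splitting of $K\otimes_k K$ by characters -/

section Idempotents

variable {k : Type v} {K : Type u} [Field k] [Field K] [Algebra k K]

/-- The character `x ⊗ y ↦ x σ(y)` of `K ⊗ K`. -/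
noncomputable def character (σ : K ≃ₐ[k] K) : K ⊗[k] K →ₐ[K] K :=
  Algebra.TensorProduct.lift (AlgHom.id K K) (σ : K →ₐ[k] K) fun _ _ => Commute.all _ _

@[simp]
theorem character_tmul (σ : K ≃ₐ[k] K) (x y : K) : character σ (x ⊗ₜ[k] y) = x * σ y := by
  simp [character]

/-- The characters of `K ⊗ K`, as a map to a product of copies of `K`. -/
noncomputable def characters (k : Type v) (K : Type u) [Field k] [Field K] [Algebra k K] :
    K ⊗[k] K →ₗ[K] ((K ≃ₐ[k] K) → K) :=
  LinearMap.pi fun σ => (character σ).toLinearMap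

variable [FiniteDimensional k K]

/-- A functional that kills the range, evaluated at the images of $1\otimes y$, is a linear relation
between the automorphisms $\sigma$, hence trivial by Dedekind. -/
theorem range_characters : LinearMap.range (characters k K) = ⊤ := by
  classical
  by_contra h
  obtain ⟨f, hf, hle⟩ := Submodule.exists_le_ker_of_lt_top _ (lt_top_iff_ne_top.2 h)
  apply hf
  have hli := (linearIndependent_toLinearMap k K K).comp
    (fun σ : K ≃ₐ[k] K => (σ : K →ₐ[k] K)) fun σ τ h => AlgEquiv.coe_toAlgHom_injective h
  rw [Fintype.linearIndependent_iff] at hli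
  have h0 := hli (fun σ => f (Pi.single σ 1)) (by
    ext y
    have := hle ⟨1 ⊗ₜ y, rfl⟩
    have hsingle : ∀ σ : K ≃ₐ[k] K, (fun τ => if σ = τ then (1 : K) else 0) = Pi.single σ 1 := by
      intro σ
      funext τ
      rw [Pi.single_apply]
      simp only [eq_comm]
    rw [LinearMap.mem_ker, LinearMap.pi_apply_eq_sum_univ] at this
    simp only [hsingle] at this
    simpa [characters, LinearMap.sum_apply, mul_comm] using this)
  refine LinearMap.pi_ext' fun σ => LinearMap.ext_ring ?_
  simpa using h0 σ

variable [IsGalois k K]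

theorem bijective_characters : Function.Bijective (characters k K) := by
  have hs : Function.Surjective (characters k K) := LinearMap.range_eq_top.1 range_characters
  -- Both dimensions over $K$ equal $[K:k]$, the order of the Galois group; this is where being
  -- Galois is essential.
  refine ⟨(LinearMap.injective_iff_surjective_of_finrank_eq_finrank ?_).2 hs, hs⟩
  rw [Module.finrank_baseChange, Module.finrank_fintype_fun_eq_card, ← Nat.card_eq_fintype_card,
    IsGalois.card_aut_eq_finrank]

/-- The idempotent of `K ⊗ K` belonging to an automorphism of `K` over `k`. -/
noncomputable def idem (σ : K ≃ₐ[k] K) : K ⊗[k] K :=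
  open Classical in (bijective_characters.2 (Pi.single σ (1 : K))).choose

open Classical in
theorem character_idem (σ τ : K ≃ₐ[k] K) : character τ (idem σ) = if τ = σ then 1 else 0 := by
  have h := congrFun (bijective_characters.2 (Pi.single σ (1 : K))).choose_spec τ
  rw [Pi.single_apply] at h
  exact h

theorem character_idem_self (σ : K ≃ₐ[k] K) : character σ (idem σ) = 1 := by
  simp [character_idem]

theorem character_idem_ne {σ τ : K ≃ₐ[k] K} (h : τ ≠ σ) : character τ (idem σ) = 0 := by
  simp [character_idem, h]

theorem ext_character {a b : K ⊗[k] K} (h : ∀ σ, character σ a = character σ b) : a = b :=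
  bijective_characters.1 (funext h)

theorem mul_idem (a : K ⊗[k] K) (σ : K ≃ₐ[k] K) : a * idem σ = character σ a • idem σ := by
  classical
  refine ext_character fun τ => ?_
  rw [map_mul, map_smul, smul_eq_mul, character_idem]
  split_ifs with h
  · rw [h]
  · simp

theorem sum_idem : ∑ σ : K ≃ₐ[k] K, idem σ = 1 := by
  classical
  refine ext_character fun τ => ?_
  simp [map_sum, character_idem]

theorem sum_idem_smul {V : Type*} [AddCommGroup V] [Module (K ⊗[k] K) V] (v : V) : ∑ σ : K ≃ₐ[k] K, idem σ • v = v := by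
  rw [← Finset.sum_smul, sum_idem, one_smul]

end Idempotents

/-! ### Eigenspaces, simple objects and multiplicities -/

section Parts

variable {k : Type v} {K : Type u} [Field k] [Field K] [Algebra k K]
variable {V : Type u} [AddCommGroup V] [Module K V] [Module (K ⊗[k] K) V]
  [IsScalarTower K (K ⊗[k] K) V]
variable {W : Type u} [AddCommGroup W] [Module K W] [Module (K ⊗[k] K) W]
  [IsScalarTower K (K ⊗[k] K) W]

variable (V) in
/-- The subspace on which `K ⊗ K` acts by the character of `σ`. -/
def part (σ : K ≃ₐ[k] K) : Submodule (K ⊗[k] K) V where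
  carrier := {v | ∀ a : K ⊗[k] K, a • v = character σ a • v}
  add_mem' hv hw a := by rw [smul_add, smul_add, hv a, hw a]
  zero_mem' a := by rw [smul_zero, smul_zero]
  smul_mem' b v hv a := by
    rw [hv b, hv.out b |>.symm, smul_smul, mul_comm, mul_smul, hv a,
      ← algebraMap_smul (K ⊗[k] K) (character σ a) v,
      ← algebraMap_smul (K ⊗[k] K) (character σ a) (b • v), smul_smul, smul_smul, mul_comm]

theorem map_mem_part (f : V →ₗ[K ⊗[k] K] W) {σ : K ≃ₐ[k] K} {v : V} (hv : v ∈ part V σ) :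
    f v ∈ part W σ := by
  intro a
  rw [← map_smul, hv a, ← algebraMap_smul (K ⊗[k] K) (character σ a) v, map_smul,
    algebraMap_smul]

theorem mem_part_of_map {f : V →ₗ[K ⊗[k] K] W} (hf : Function.Injective f) {σ : K ≃ₐ[k] K} {v : V}
    (hv : f v ∈ part W σ) : v ∈ part V σ := by
  intro a
  apply hf
  rw [map_smul, hv a, ← algebraMap_smul (K ⊗[k] K) (character σ a) v, map_smul, algebraMap_smul]

/-- Any nonzero vector generates $V$ over $K\otimes_k K$, which acts on it through scalars of $K$.
-/
theorem finrank_eq_one_of_part_eq_top [IsSimpleModule (K ⊗[k] K) V] {σ : K ≃ₐ[k] K}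
    (h : part V σ = ⊤) : Module.finrank K V = 1 := by
  have : Nontrivial V := IsSimpleModule.nontrivial (K ⊗[k] K) V
  obtain ⟨v, hv⟩ := exists_ne (0 : V)
  refine finrank_eq_one v hv fun w => ?_
  obtain ⟨a, rfl⟩ := IsSimpleModule.toSpanSingleton_surjective (K ⊗[k] K) hv w
  have hm : v ∈ part V σ := h ▸ Submodule.mem_top
  exact ⟨character σ a, (hm a).symm⟩

/-- When both sides have the same character, every $K$-linear isomorphism is $K\otimes_k K$-linear.
-/
theorem nonempty_linearEquiv {σ : K ≃ₐ[k] K} (hV : part V σ = ⊤) (hW : part W σ = ⊤)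
    [Module.Finite K V] [Module.Finite K W] (h : Module.finrank K V = Module.finrank K W) :
    Nonempty (V ≃ₗ[K ⊗[k] K] W) := by
  let e := LinearEquiv.ofFinrankEq V W h
  refine ⟨{ e with map_smul' := fun a v => ?_ }⟩
  have h1 : v ∈ part V σ := hV ▸ Submodule.mem_top
  have h2 : e v ∈ part W σ := hW ▸ Submodule.mem_top
  change e (a • v) = a • e v
  rw [h1, h2, map_smul]

variable [FiniteDimensional k K] [IsGalois k K]

theorem idem_smul_mem_part (σ : K ≃ₐ[k] K) (v : V) : idem σ • v ∈ part V σ := by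
  intro a
  rw [smul_smul, mul_idem, smul_assoc]

theorem idem_smul_of_mem {σ : K ≃ₐ[k] K} {v : V} (hv : v ∈ part V σ) : idem σ • v = v := by
  rw [hv, character_idem_self, one_smul]

theorem idem_smul_of_mem_of_ne {σ τ : K ≃ₐ[k] K} (h : τ ≠ σ) {v : V} (hv : v ∈ part V τ) :
    idem σ • v = 0 := by
  rw [hv, character_idem_ne h, zero_smul]

theorem part_eq_bot_of_ne {σ τ : K ≃ₐ[k] K} (h : τ ≠ σ) (hV : part V σ = ⊤) : part V τ = ⊥ := by
  rw [eq_bot_iff]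
  intro v hv
  rw [Submodule.mem_bot, ← idem_smul_of_mem (σ := σ) (v := v) (hV ▸ Submodule.mem_top),
    idem_smul_of_mem_of_ne h hv]

/-- Taking eigenspaces is exact: applying `idem σ` moves any preimage into the eigenspace. This lets
`multiplicity` descend to $K_0$. -/
theorem finrank_part_add {V₁ V₂ V₃ : TwoSidedSpace k K} (f : V₁ →ₗ[K ⊗[k] K] V₂)
    (g : V₂ →ₗ[K ⊗[k] K] V₃) (hf : Function.Injective f) (hfg : Function.Exact f g)
    (hg : Function.Surjective g) (σ : K ≃ₐ[k] K) :
    Module.finrank K (part V₂ σ) = Module.finrank K (part V₁ σ) + Module.finrank K (part V₃ σ) := by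
  let f' : part V₁ σ →ₗ[K ⊗[k] K] part V₂ σ := f.restrict fun v hv => map_mem_part f hv
  let g' : part V₂ σ →ₗ[K ⊗[k] K] part V₃ σ := g.restrict fun v hv => map_mem_part g hv
  have hf' : Function.Injective f' := fun x y h => Subtype.ext (hf (congrArg Subtype.val h))
  have hg' : Function.Surjective g' := by
    intro x
    obtain ⟨y, hy⟩ := hg x
    refine ⟨⟨idem σ • y, idem_smul_mem_part σ y⟩, Subtype.ext ?_⟩
    exact (map_smul g _ _).trans (by rw [hy, idem_smul_of_mem x.2])
  have hk : LinearMap.ker (g'.restrictScalars K) = LinearMap.range (f'.restrictScalars K) := by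
    ext x
    constructor
    · intro hx
      obtain ⟨y, hy⟩ := (hfg x).1 (congrArg Subtype.val hx)
      exact ⟨⟨y, mem_part_of_map hf (by rw [hy]; exact x.2)⟩, Subtype.ext hy⟩
    · rintro ⟨y, rfl⟩
      exact Subtype.ext ((hfg _).2 ⟨y, rfl⟩)
  have : Module.Finite K (part V₂ σ) := (V₂.sub (part V₂ σ)).finite
  have h := LinearMap.finrank_range_add_finrank_ker (g'.restrictScalars K)
  rw [hk, LinearMap.finrank_range_of_inj (f := f'.restrictScalars K) hf',
    (LinearMap.range_eq_top (f := g'.restrictScalars K)).2 hg', finrank_top] at h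
  omega

/-- The multiplicity of the character of `σ`, as a function on the Grothendieck group. -/
noncomputable def multiplicity (σ : K ≃ₐ[k] K) : K0 k K →+ ℤ :=
  QuotientAddGroup.lift (exactRelations k K)
    (FreeAbelianGroup.lift fun V : TwoSidedSpace k K => (Module.finrank K (part V σ) : ℤ)) (by
      rw [exactRelations, AddSubgroup.closure_le]
      rintro _ ⟨A, B, C, f, g, hf, hfg, hg, rfl⟩
      simp [finrank_part_add f g hf hfg hg σ])

theorem multiplicity_rank (σ : K ≃ₐ[k] K) (V : TwoSidedSpace k K) :
    multiplicity σ V.rank = Module.finrank K (part V σ) := by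
  simp [multiplicity, TwoSidedSpace.rank]

/-- By simplicity each eigenspace is zero or everything, and they cannot all be zero because the
idempotents sum to one. -/
theorem exists_part_eq_top [IsSimpleModule (K ⊗[k] K) V] : ∃ σ : K ≃ₐ[k] K, part V σ = ⊤ := by
  by_contra! h
  have hb : ∀ σ : K ≃ₐ[k] K, part V σ = ⊥ := fun σ => (eq_bot_or_eq_top _).resolve_right (h σ)
  have : Nontrivial V := IsSimpleModule.nontrivial (K ⊗[k] K) V
  obtain ⟨v, hv⟩ := exists_ne (0 : V)
  apply hv
  rw [← sum_idem_smul (k := k) (K := K) v]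
  refine Finset.sum_eq_zero fun σ _ => ?_
  have := idem_smul_mem_part σ v
  rwa [hb, Submodule.mem_bot] at this

end Parts

/-! ### Homogeneous components as eigenspaces -/

section Components

variable {k : Type v} {K : Type u} [Field k] [Field K] [Algebra k K]

/-- Subquotients inherit the character, so a simple one is a line with the same character as $S$. -/
theorem isHomogeneous_part {S V : TwoSidedSpace k K} [IsSimpleModule (K ⊗[k] K) S]
    {σ : K ≃ₐ[k] K} (hS : part S σ = ⊤) : IsHomogeneous S V (part V σ) := by
  intro N N' hN' hcov
  have hs : IsSimpleModule (K ⊗[k] K) (N' ⧸ N.comap N'.subtype) :=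
    (covBy_iff_quot_is_simple hcov.le).1 hcov
  have hp : part (N' ⧸ N.comap N'.subtype) σ = ⊤ := by
    rw [eq_top_iff]
    intro x _
    obtain ⟨y, rfl⟩ := Submodule.mkQ_surjective _ x
    exact map_mem_part _ (mem_part_of_map (f := N'.subtype) N'.injective_subtype (hN' y.2))
  have h1 := finrank_eq_one_of_part_eq_top hp
  have : Module.Finite K (N' ⧸ N.comap N'.subtype) :=
    Module.finite_of_finrank_pos (by rw [h1]; exact one_pos)
  exact nonempty_linearEquiv hp hS (h1.trans (finrank_eq_one_of_part_eq_top hS).symm)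

theorem bot_covBy_span {V : TwoSidedSpace k K} {τ : K ≃ₐ[k] K} {w : V} (hw : w ∈ part V τ)
    (h0 : w ≠ 0) : ⊥ ⋖ Submodule.span (K ⊗[k] K) {w} := by
  rw [bot_covBy_iff]
  refine ⟨fun h => h0 (Submodule.span_singleton_eq_bot.1 h), fun N hN => ?_⟩
  by_contra hN0
  obtain ⟨x, hx, hx0⟩ := Submodule.exists_mem_ne_zero_of_ne_bot hN0
  obtain ⟨a, rfl⟩ := Submodule.mem_span_singleton.1 (hN.le hx)
  rw [hw a] at hx hx0
  have hc : character τ a ≠ 0 := fun h => hx0 (by rw [h, zero_smul])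
  refine hN.not_ge ((Submodule.span_singleton_le_iff_mem _ _).2 ?_)
  have := N.smul_mem (algebraMap K (K ⊗[k] K) (character τ a)⁻¹) hx
  rwa [algebraMap_smul, smul_smul, inv_mul_cancel₀ hc, one_smul] at this

theorem isScalarSet_imφ_sub (V : TwoSidedSpace k K) (σ : K ≃ₐ[k] K) :
    IsScalarSet (V.sub (part V σ)).imφ := by
  rintro _ ⟨x, rfl⟩
  refine ⟨σ x, fun v => Subtype.ext ?_⟩
  have := v.2 (1 ⊗ₜ x)
  rw [character_tmul, one_mul] at this
  exact this

variable [FiniteDimensional k K] [IsGalois k K]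

theorem IsHomogeneous.le_part {S V : TwoSidedSpace k K} {σ : K ≃ₐ[k] K} (hS : part S σ = ⊤)
    {P : Submodule (K ⊗[k] K) V} (hP : IsHomogeneous S V P) : P ≤ part V σ := by
  intro v hv
  have hz : ∀ τ, τ ≠ σ → (idem τ : K ⊗[k] K) • v = 0 := by
    intro τ hτ
    -- A nonzero $\tau$-component of `v` would span a simple subspace of `P`. There `idem σ` acts as
    -- zero, whereas on $S$ it acts as the identity.
    by_contra h0
    have hw := idem_smul_mem_part τ v
    set w := (idem τ : K ⊗[k] K) • v with hwdef
    obtain ⟨e⟩ := hP ⊥ (Submodule.span (K ⊗[k] K) {w})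
      ((Submodule.span_singleton_le_iff_mem _ _).2 (P.smul_mem _ hv)) (bot_covBy_span hw h0)
    let w' : Submodule.span (K ⊗[k] K) {w} := ⟨w, Submodule.mem_span_singleton_self w⟩
    let x := Submodule.Quotient.mk (p := (⊥ : Submodule (K ⊗[k] K) V).comap
      (Submodule.span (K ⊗[k] K) {w}).subtype) w'
    have hx : (idem σ : K ⊗[k] K) • w' = 0 := Subtype.ext (idem_smul_of_mem_of_ne hτ hw)
    have hx' : (idem σ : K ⊗[k] K) • x = 0 := by
      change Submodule.Quotient.mk ((idem σ : K ⊗[k] K) • w') = _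
      rw [hx]
      rfl
    have h1 : e x = 0 := by
      rw [← idem_smul_of_mem (σ := σ) (v := e x) (hS ▸ Submodule.mem_top), ← map_smul, hx',
        map_zero]
    have h2 : x = 0 := e.injective (h1.trans (map_zero e).symm)
    exact h0 ((Submodule.Quotient.mk_eq_zero _).1 h2)
  rw [← sum_idem_smul (k := k) (K := K) v,
    Finset.sum_eq_single σ (fun τ _ h => hz τ h) (fun h => (h (Finset.mem_univ _)).elim)]
  exact idem_smul_mem_part σ v

theorem component_eq {S V : TwoSidedSpace k K} [IsSimpleModule (K ⊗[k] K) S]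
    {σ : K ≃ₐ[k] K} (hS : part S σ = ⊤) : V.component S = V.sub (part V σ) := by
  rw [TwoSidedSpace.component]
  congr 1
  exact le_antisymm (sSup_le fun P hP => IsHomogeneous.le_part hS hP)
    (le_sSup (isHomogeneous_part hS))

theorem isScalarSet_imφ_component {S V : TwoSidedSpace k K} [IsSimpleModule (K ⊗[k] K) S] :
    IsScalarSet (V.component S).imφ := by
  obtain ⟨σ, hσ⟩ := exists_part_eq_top (k := k) (K := K) (V := S)
  rw [component_eq hσ]
  exact isScalarSet_imφ_sub V σ

theorem finrank_component {S V : TwoSidedSpace k K} [IsSimpleModule (K ⊗[k] K) S]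
    {σ : K ≃ₐ[k] K} (hS : part S σ = ⊤) :
    (Module.finrank K (V.component S) : ℤ) = multiplicity σ V.rank := by
  rw [component_eq hS, multiplicity_rank]
  rfl

variable {r : ℕ} {S : Fin r → TwoSidedSpace k K}

/-- Non-isomorphic simples have different characters, so the multiplicities are dual to the classes
$[S_i]$. -/
theorem multiplicity_sum (hS : ∀ i, IsSimpleModule (K ⊗[k] K) (S i))
    (hne : ∀ i j, i ≠ j → IsEmpty (S i ≃ₗ[K ⊗[k] K] S j)) (q : Fin r → ℕ) {i : Fin r}
    {σ : K ≃ₐ[k] K} (hσ : part (S i) σ = ⊤) :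
    multiplicity σ (∑ j, q j • (S j).rank) = q i := by
  rw [map_sum, Finset.sum_eq_single i]
  · rw [map_nsmul, multiplicity_rank, hσ]
    have h := finrank_eq_one_of_part_eq_top hσ
    have h' : Module.finrank K (⊤ : Submodule (K ⊗[k] K) (S i)) = 1 :=
      (LinearEquiv.finrank_eq
        ((Submodule.topEquiv (R := K ⊗[k] K) (M := S i)).restrictScalars K)).trans h
    rw [h']
    simp
  · intro j _ hj
    obtain ⟨τ, hτ⟩ := exists_part_eq_top (k := k) (K := K) (V := S j)
    have hστ : σ ≠ τ := by
      rintro rfl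
      exact (hne j i hj).elim (nonempty_linearEquiv hτ hσ
        ((finrank_eq_one_of_part_eq_top hτ).trans (finrank_eq_one_of_part_eq_top hσ).symm)).some
    have h' : Module.finrank K (⊥ : Submodule (K ⊗[k] K) (S j)) = 0 :=
      Module.finrank_zero_of_subsingleton
    rw [map_nsmul, multiplicity_rank, part_eq_bot_of_ne hστ hτ, h']
    simp
  · exact fun h => (h (Finset.mem_univ _)).elim

theorem eq_of_sum_rank_eq (hS : ∀ i, IsSimpleModule (K ⊗[k] K) (S i))
    (hne : ∀ i j, i ≠ j → IsEmpty (S i ≃ₗ[K ⊗[k] K] S j)) {q q' : Fin r → ℕ}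
    (h : ∑ j, q j • (S j).rank = ∑ j, q' j • (S j).rank) : q = q' := by
  funext i
  obtain ⟨σ, hσ⟩ := exists_part_eq_top (k := k) (K := K) (V := S i)
  have := congrArg (multiplicity σ) h
  rw [multiplicity_sum hS hne q hσ, multiplicity_sum hS hne q' hσ] at this
  exact_mod_cast this

theorem finrank_component_of_rank_eq (hS : ∀ i, IsSimpleModule (K ⊗[k] K) (S i))
    (hne : ∀ i j, i ≠ j → IsEmpty (S i ≃ₗ[K ⊗[k] K] S j)) {V : TwoSidedSpace k K}
    {l : Fin r → ℕ} (hV : V.rank = ∑ i, l i • (S i).rank) (i : Fin r) :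
    Module.finrank K (V.component (S i)) = l i := by
  obtain ⟨σ, hσ⟩ := exists_part_eq_top (k := k) (K := K) (V := S i)
  have h := finrank_component (V := V) hσ
  rw [hV, multiplicity_sum hS hne l hσ] at h
  exact_mod_cast h

theorem finrank_eq_one {T : TwoSidedSpace k K} [IsSimpleModule (K ⊗[k] K) T] :
    Module.finrank K T = 1 := by
  obtain ⟨σ, hσ⟩ := exists_part_eq_top (k := k) (K := K) (V := T)
  exact finrank_eq_one_of_part_eq_top hσ

end Components

/-! ### The functors for scalar endomorphisms -/

section Functors

variable {K : Type u} [Field K] {ι : Type} (m : ι → ℕ) {U : ι → Type u}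
  [∀ i, AddCommGroup (U i)] [∀ i, Module K (U i)] {A : ∀ i, Set (Module.End K (U i))}

theorem prodFA_eq_prodG (hA : ∀ i, IsScalarSet (A i)) : prodFA m U A = prodG m U := by
  ext R M
  exact ⟨fun h i => (h i).1, fun h i => ⟨h i, (hA i).isInvariant (M i)⟩⟩

theorem prodGA_eq_prodG (hA : ∀ i, IsScalarSet (A i)) : prodGA m U A = prodG m U := by
  ext R M
  exact ⟨fun h i => (h i).1, fun h i => ⟨h i, (hA i).isGeneratedByInvariants (h i)⟩⟩

theorem prodHA_eq_prodG (hA : ∀ i, IsScalarSet (A i)) : prodHA m U A = prodG m U := by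
  rw [prodHA, prodFA_eq_prodG m hA, prodGA_eq_prodG m hA, inf_idem]

theorem prodLocFA_eq_prodLocG [∀ i, Module.Finite K (U i)] (hA : ∀ i, IsScalarSet (A i)) :
    prodLocFA m U A = prodLocG m U := by
  ext R M
  exact ⟨fun h i => (h i).1, fun h i => ⟨h i, (hA i).isInvariant (M i)⟩⟩

end Functors

/-! ### The functors at a class $\sum q_i[S_i]$ -/

section Values

variable {k : Type v} {K : Type u} [Field k] [Field K] [Algebra k K]
variable [FiniteDimensional k K] [IsGalois k K]
variable {r : ℕ} {S : Fin r → TwoSidedSpace k K}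

theorem Fφ_sum_eq (hS : ∀ i, IsSimpleModule (K ⊗[k] K) (S i))
    (hne : ∀ i j, i ≠ j → IsEmpty (S i ≃ₗ[K ⊗[k] K] S j)) (V : TwoSidedSpace k K)
    (q : Fin r → ℕ) :
    Fφ S V (∑ i, q i • (S i).rank) = prodG (K := K) q fun i => V.component (S i) := by
  have hq : (fun i => q i * Module.finrank K (S i)) = q := by
    funext i
    rw [finrank_eq_one, mul_one]
  have h : Fφ S V (∑ i, q i • (S i).rank) =
      prodFA (fun i => q i * Module.finrank K (S i)) _ fun i => (V.component (S i)).imφ :=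
    -- The coefficients are determined by the class, so the supremum has only one term.
    le_antisymm (iSup₂_le fun q' hq' => by rw [eq_of_sum_rank_eq hS hne hq'])
      (le_iSup₂_of_le q rfl le_rfl)
  rw [h, prodFA_eq_prodG _ fun i => isScalarSet_imφ_component, hq]

theorem locFφ_sum_eq (hS : ∀ i, IsSimpleModule (K ⊗[k] K) (S i))
    (hne : ∀ i j, i ≠ j → IsEmpty (S i ≃ₗ[K ⊗[k] K] S j)) (V : TwoSidedSpace k K)
    (q : Fin r → ℕ) :
    locFφ S V (∑ i, q i • (S i).rank) = prodLocG (K := K) q fun i => V.component (S i) := by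
  have hq : (fun i => q i * Module.finrank K (S i)) = q := by
    funext i
    rw [finrank_eq_one, mul_one]
  have h : locFφ S V (∑ i, q i • (S i).rank) =
      prodLocFA (fun i => q i * Module.finrank K (S i)) _ fun i => (V.component (S i)).imφ :=
    le_antisymm (iSup₂_le fun q' hq' => by rw [eq_of_sum_rank_eq hS hne hq'])
      (le_iSup₂_of_le q rfl le_rfl)
  rw [h, prodLocFA_eq_prodLocG _ fun i => isScalarSet_imφ_component, hq]

end Values

end TwoSided

/-! ### The main theorem -/

open TwoSided
theorem mainTheorem6 {k : Type v} {K : Type u} [Field k] [Field K] [Algebra k K]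
    [FiniteDimensional k K] [IsGalois k K]
    (V : TwoSidedSpace k K) (r : ℕ) (S : Fin r → TwoSidedSpace k K) (l : Fin r → ℕ)
    (hS : ∀ i, IsSimpleModule (K ⊗[k] K) (S i))
    (hne : ∀ i j, i ≠ j → IsEmpty (S i ≃ₗ[K ⊗[k] K] S j))
    (hV : V.rank = ∑ i, l i • (S i).rank) :
    (∀ W : TwoSidedSpace k K,
      Fφ S V W.rank = Gφ S V W.rank ∧ Gφ S V W.rank = Hφ S V W.rank) ∧
    ∀ q : Fin r → ℕ,
      Nonempty ((Fφ S V (∑ i, q i • (S i).rank)).toFunctor ≅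
        (prodG (K := K) q fun i => Fin (l i) → K).toFunctor) ∧
      Nonempty ((locFφ S V (∑ i, q i • (S i).rank)).toFunctor ≅
        (prodLocG (K := K) q fun i => Fin (l i) → K).toFunctor) ∧
      ∀ Y : Fin r → Over (Spec (CommRingCat.of K)), (∀ i, IsGrassmannian (q i) (l i) (Y i)) →
        ∀ X : Over (Spec (CommRingCat.of K)),
          Represents X (locFφ S V (∑ i, q i • (S i).rank)).toFunctor ↔ IsProduct X Y := by
  have hA : ∀ i, IsScalarSet (V.component (S i)).imφ := fun i => isScalarSet_imφ_component
  refine ⟨fun W => ⟨?_, ?_⟩, fun q => ?_⟩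
  -- Both sides become the same supremum of products of Grassmannian functors. This also covers
  -- classes not of the required form, where the supremum is empty.
  · simp only [Fφ, Gφ, prodFA_eq_prodG _ hA, prodGA_eq_prodG _ hA]
  · simp only [Gφ, Hφ, prodGA_eq_prodG _ hA, prodHA_eq_prodG _ hA]
  · let e : ∀ i, V.component (S i) ≃ₗ[K] (Fin (l i) → K) := fun i =>
      LinearEquiv.ofFinrankEq _ _ (by
        rw [finrank_component_of_rank_eq hS hne hV, Module.finrank_fin_fun])
    rw [Fφ_sum_eq hS hne, locFφ_sum_eq hS hne]
    obtain ⟨a⟩ := prodLocG_iso_of_equiv e q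
    exact ⟨prodG_iso_of_equiv e q, ⟨a⟩, fun Y hY X =>
      (represents_congr a X).trans (represents_prodLocG_iff q l hY X)⟩
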